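/- Let $A=M_2(\mathbb H)\oplus M_4(\mathbb C)$, a real involutive algebra, with $M_2(\mathbb H)\subset M_4(\mathbb C)$ through the usual inclusion $\mathbb H\subset M_2(\mathbb C)$ that sends $\lambda\in\mathbb C\subset\mathbb H$ to $\lambda\oplus\bar\lambda=\mathrm{diag}(\lambda,\bar\lambda)$. Let $A$ act on the $32$-dimensional Hilbert space $\mathcal H=M_4(\mathbb C)\oplus M_4(\mathbb C)$ by left multiplication, $(X,Y)(x,y)=(Xx,Yy)$. Let $J(x,y)=(y^*,x^*)$ be the anti-unitary real structure and let $\gamma(x,y)=(gx,-yg)$, $g=\mathrm{diag}(1,1,-1,-1)$, be the grading, so that $J^2=1$ and $J\gamma=-\gamma J$. Let $A^{\mathrm{ev}}=\mathbb H\oplus\mathbb H\oplus M_4(\mathbb C)\subset A$ be the even part of $A$ (the elements commuting with $\gamma$), with $\mathbb H\oplus\mathbb H\subset M_2(\mathbb H)$ the diagonal matrices. For $b\in A^{\mathrm{ev}}$ put $b^\circ=Jb^*J^{-1}$. A real involutive (i.e. $*$-closed) subalgebra $B\subset A^{\mathrm{ev}}$ is said to admit an off-diagonal Dirac operator if there is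 a self-adjoint operator $D$ on $\mathcal H$ with $DJ=JD$ and $D\gamma=-\gamma D$ (the relations of KO-dimension $6$) that satisfies the order-one condition $[[D,a],b^\circ]=0$ for all $a,b\in B$ and does not commute with the center of $A$: $[D,Z(A)]\neq\{0\}$. Theorem. Up to automorphisms of $A^{\mathrm{ev}}$ there exists a unique involutive subalgebra of $A^{\mathrm{ev}}$ of maximal real dimension among those that admit an off-diagonal Dirac operator. It is $$A_F=\{((\lambda\oplus\bar\lambda)\oplus q,\ \lambda\oplus m)\;:\;\lambda\in\mathbb C,\ q\in\mathbb H,\ m\in M_3(\mathbb C)\}\subset\mathbb H\oplus\mathbb H\oplus M_4(\mathbb C).$$ That is: $A_F$ admits an off-diagonal Dirac operator and has the maximal dimension among the involutive subalgebras that do; and every involutive subalgebra admitting an off-diagonal Dirac operator and having this maximal dimension is the image of $A_F$ under an automorphism of the real involutive algebra $A^{\mathrm{ev}}$. Moreover $A_F$ is isomorphic, as a real involutive algebra, to $\mathbb C\oplus\mathbb H\oplus M_3(\mathbb C)$. -/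

import Mathlib

/-- The standard inclusion `ℍ ⊂ M₂(ℂ)`, a unital real `*`-homomorphism; on `ℂ ⊂ ℍ` it is
`λ ↦ diag (λ, conj λ)`. -/
noncomputable def quatToMatrix : Quaternion ℝ →⋆ₐ[ℝ] Matrix (Fin 2) (Fin 2) ℂ where
  toFun q := !![⟨q.re, q.imI⟩, ⟨q.imJ, q.imK⟩; ⟨-q.imJ, q.imK⟩, ⟨q.re, -q.imI⟩]
  map_one' := by
    ext i j; fin_cases i <;> fin_cases j <;> (simp [Complex.ext_iff]; constructor <;> rfl)
  map_mul' p q := by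
    ext i j; fin_cases i <;> fin_cases j <;>
      simp [Complex.ext_iff, Matrix.mul_apply, Fin.sum_univ_two] <;> constructor <;> ring
  map_zero' := by
    ext i j; fin_cases i <;> fin_cases j <;> (simp [Complex.ext_iff]; constructor <;> rfl)
  map_add' p q := by
    ext i j; fin_cases i <;> fin_cases j <;> simp [Complex.ext_iff] <;> ring
  commutes' r := by
    ext i j; fin_cases i <;> fin_cases j <;>
      simp [Complex.ext_iff, Matrix.algebraMap_matrix_apply]
  map_star' q := by
    ext i j; fin_cases i <;> fin_cases j <;> simp [Complex.ext_iff]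

/-- The full finite algebra `A = M₂(ℍ) ⊕ M₄(ℂ)`, a real involutive algebra. -/
abbrev FullAlg : Type :=
  Matrix (Fin 2) (Fin 2) (Quaternion ℝ) × Matrix (Fin 4) (Fin 4) ℂ

/-- The algebra `A^ev = ℍ ⊕ ℍ ⊕ M₄(ℂ)`, a real involutive algebra. -/
abbrev EvAlg : Type :=
  Quaternion ℝ × Quaternion ℝ × Matrix (Fin 4) (Fin 4) ℂ

/-- The inclusion `A^ev ⊂ A`, `(p, q, Y) ↦ (diag (p, q), Y)`. -/
noncomputable def evIncl : EvAlg →⋆ₐ[ℝ] FullAlg where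
  toFun a := (Matrix.diagonal ![a.1, a.2.1], a.2.2)
  map_one' := by
    refine Prod.ext (Matrix.ext fun i j => ?_) rfl
    fin_cases i <;> fin_cases j <;> simp
  map_mul' a b := by
    refine Prod.ext (Matrix.ext fun i j => ?_) rfl
    fin_cases i <;> fin_cases j <;> simp
  map_zero' := by
    refine Prod.ext (Matrix.ext fun i j => ?_) rfl
    fin_cases i <;> fin_cases j <;> simp
  map_add' a b := by
    refine Prod.ext (Matrix.ext fun i j => ?_) rfl
    fin_cases i <;> fin_cases j <;> simp
  commutes' r := by
    refine Prod.ext (Matrix.ext fun i j => ?_) rfl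
    fin_cases i <;> fin_cases j <;> simp [Matrix.algebraMap_matrix_apply]
  map_star' a := by
    refine Prod.ext (Matrix.ext fun i j => ?_) rfl
    fin_cases i <;> fin_cases j <;> simp

/-- Indices `(α, I)` of the space `M₄(ℂ)` of `4 × 4` matrices: `α = (chirality, component)` is the
index on which `M₂(ℍ) ⊂ M₄(ℂ)` acts, `I` the one on which `M₄(ℂ)` acts. -/
abbrev HalfIdx : Type := (Fin 2 × Fin 2) × Fin 4

/-- The 32-dimensional Hilbert space `M₄(ℂ) ⊕ M₄(ℂ)`. A pair `(x, y)` of matrices corresponds to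
the vector `ψ` with `ψ (inl (α, I)) = x α I` and `ψ (inr (α, I)) = y I α`. -/
abbrev FermionSpace : Type := EuclideanSpace ℂ (HalfIdx ⊕ HalfIdx)

/-- The inclusion `M₂(ℍ) ⊂ M₄(ℂ)`, entrywise `quatToMatrix`. -/
noncomputable def quatBlock : Matrix (Fin 2) (Fin 2) (Quaternion ℝ) →⋆ₐ[ℝ]
    Matrix (Fin 2 × Fin 2) (Fin 2 × Fin 2) ℂ where
  toFun X := Matrix.of fun s t => quatToMatrix (X s.1 t.1) s.2 t.2
  map_one' := by
    ext ⟨i, k⟩ ⟨j, l⟩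
    by_cases h : i = j <;> simp [h, Matrix.one_apply]
  map_mul' X Y := by
    ext ⟨i, k⟩ ⟨j, l⟩
    simp [Matrix.mul_apply, Fintype.sum_prod_type]
  map_zero' := by
    ext s t
    simp
  map_add' X Y := by
    ext s t
    simp
  commutes' r := by
    ext ⟨i, k⟩ ⟨j, l⟩
    have hr : quatToMatrix (r : Quaternion ℝ) = algebraMap ℝ _ r :=
      AlgHomClass.commutes quatToMatrix r
    by_cases h : i = j <;> simp [h, Matrix.algebraMap_matrix_apply, hr]
  map_star' X := by
    ext ⟨i, k⟩ ⟨j, l⟩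
    simp [map_star]

open Kronecker in
/-- The matrix of `(X, Y) ∈ M₂(ℍ) ⊕ M₄(ℂ)` on `ℂ³²`: it is left multiplication
`(x, y) ↦ (X x, Y y)` on `M₄(ℂ) ⊕ M₄(ℂ)`, i.e. `X` acts on the index `α` of the first summand and
`Y` on the index `I` of the second one. -/
noncomputable def repMatrix :
    FullAlg →⋆ₐ[ℝ] Matrix (HalfIdx ⊕ HalfIdx) (HalfIdx ⊕ HalfIdx) ℂ where
  toFun a := Matrix.fromBlocks
    (quatBlock a.1 ⊗ₖ (1 : Matrix (Fin 4) (Fin 4) ℂ)) 0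
    0 ((1 : Matrix (Fin 2 × Fin 2) (Fin 2 × Fin 2) ℂ) ⊗ₖ a.2)
  map_one' := by
    simp
  map_mul' a b := by
    simp [Matrix.fromBlocks_multiply, ← Matrix.mul_kronecker_mul]
  map_zero' := by
    simp
  map_add' a b := by
    simp [Matrix.fromBlocks_add, Matrix.add_kronecker, Matrix.kronecker_add]
  commutes' r := by
    simp [Algebra.algebraMap_eq_smul_one, Matrix.smul_kronecker, Matrix.kronecker_smul,
      ← Matrix.fromBlocks_one, Matrix.fromBlocks_smul]
  map_star' a := by
    rw [Matrix.star_eq_conjTranspose, Matrix.fromBlocks_conjTranspose,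
      Matrix.conjTranspose_kronecker, Matrix.conjTranspose_kronecker]
    rw [Prod.fst_star, Prod.snd_star, map_star]
    simp only [Matrix.star_eq_conjTranspose, Matrix.conjTranspose_one, Matrix.conjTranspose_zero]

/-- The representation of `A = M₂(ℍ) ⊕ M₄(ℂ)` on the Hilbert space. -/
noncomputable def rep : FullAlg →⋆ₐ[ℝ] (FermionSpace →L[ℂ] FermionSpace) where
  toFun a := Matrix.toEuclideanCLM (𝕜 := ℂ) (repMatrix a)
  map_one' := by simp
  map_mul' a b := by simp
  map_zero' := by simp
  map_add' a b := by simp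
  commutes' r := by
    ext ψ p
    simp [Algebra.algebraMap_eq_smul_one, Matrix.smul_mulVec]
  map_star' a := by simp [map_star]

/-- The representation of `A^ev`. -/
noncomputable def repEv : EvAlg →⋆ₐ[ℝ] (FermionSpace →L[ℂ] FermionSpace) := rep.comp evIncl

/-- The real structure: the anti-unitary operator `J (x, y) = (y*, x*)` on `M₄(ℂ) ⊕ M₄(ℂ)`,
which in coordinates exchanges the two summands and conjugates. -/
noncomputable def realStructure : FermionSpace ≃ₗᵢ⋆[ℂ] FermionSpace where
  toFun ψ := WithLp.toLp 2 fun p => star (ψ p.swap)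
  invFun ψ := WithLp.toLp 2 fun p => star (ψ p.swap)
  left_inv ψ := by ext p; simp
  right_inv ψ := by ext p; simp
  map_add' ψ φ := by ext p; simp
  map_smul' c ψ := by ext p; simp
  norm_map' ψ := by
    simp [EuclideanSpace.norm_eq, add_comm]

/-- The sign of `γ` on a basis vector: on the first summand `+1` on the first copy of `ℍ`, `-1` on
the second copy, and the opposite on the second summand. -/
def chiralitySign : HalfIdx ⊕ HalfIdx → ℂ
  | Sum.inl p => if p.1.1 = 0 then 1 else -1
  | Sum.inr p => if p.1.1 = 0 then -1 else 1

/-- The grading `γ (x, y) = (g x, - y g)`, with `g = diag (1, 1, -1, -1)`. -/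
noncomputable def grading : FermionSpace →L[ℂ] FermionSpace :=
  Matrix.toEuclideanCLM (𝕜 := ℂ) (Matrix.diagonal chiralitySign)

/-- The opposite operator `b° = J b* J⁻¹` of `b ∈ A^ev`. -/
noncomputable def opp (b : EvAlg) : FermionSpace →L[ℂ] FermionSpace :=
  (realStructure.toLinearIsometry.toContinuousLinearMap.comp
    ((repEv (star b)).comp
      realStructure.symm.toLinearIsometry.toContinuousLinearMap) : FermionSpace →L[ℂ] FermionSpace)

/-- `D` is a Dirac operator for `(γ, J)` in KO-dimension 6: it is self-adjoint, commutes with `J`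
and anticommutes with `γ`. -/
structure IsDirac (D : FermionSpace →L[ℂ] FermionSpace) : Prop where
  selfAdjoint : IsSelfAdjoint D
  comm_J : ∀ ψ, D (realStructure ψ) = realStructure (D ψ)
  anticomm_grading : D * grading = -(grading * D)

/-- The order-one condition `[[D, a], b°] = 0` for all `a, b` in the subalgebra `B`. -/
def OrderOne (B : NonUnitalStarSubalgebra ℝ EvAlg) (D : FermionSpace →L[ℂ] FermionSpace) : Prop :=
  ∀ a ∈ B, ∀ b ∈ B, ⁅⁅D, repEv a⁆, opp b⁆ = 0

/-- `D` is off-diagonal: `[D, Z(A)] ≠ {0}`, with `Z(A)` the center of `A = M₂(ℍ) ⊕ M₄(ℂ)`. -/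
def IsOffDiagonal (D : FermionSpace →L[ℂ] FermionSpace) : Prop :=
  ∃ z ∈ Subalgebra.center ℝ FullAlg, ⁅D, rep z⁆ ≠ 0

/-- The involutive subalgebra `B ⊂ A^ev` (not assumed to contain the unit) admits an off-diagonal
Dirac operator. -/
def AdmitsOffDiagonalDirac (B : NonUnitalStarSubalgebra ℝ EvAlg) : Prop :=
  ∃ D : FermionSpace →L[ℂ] FermionSpace, IsDirac D ∧ OrderOne B D ∧ IsOffDiagonal D

/-- `B` has maximal (real) dimension among the involutive subalgebras of `A^ev` admitting an
off-diagonal Dirac operator. -/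
def IsMaximalAdmitting (B : NonUnitalStarSubalgebra ℝ EvAlg) : Prop :=
  AdmitsOffDiagonalDirac B ∧
    ∀ B' : NonUnitalStarSubalgebra ℝ EvAlg, AdmitsOffDiagonalDirac B' →
      Module.finrank ℝ B' ≤ Module.finrank ℝ B

/-- The block-diagonal matrix `λ ⊕ m ∈ M₄(ℂ)`, for `λ ∈ ℂ` and `m ∈ M₃(ℂ)`. -/
def blockSum (l : ℂ) (m : Matrix (Fin 3) (Fin 3) ℂ) : Matrix (Fin 4) (Fin 4) ℂ :=
  Matrix.reindex (finSumFinEquiv (m := 1) (n := 3)) (finSumFinEquiv (m := 1) (n := 3))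
    (Matrix.fromBlocks (Matrix.diagonal fun _ => l) 0 0 m)

theorem blockSum_zero : blockSum 0 0 = 0 := by
  simp [blockSum]

theorem blockSum_add (l l' : ℂ) (m m' : Matrix (Fin 3) (Fin 3) ℂ) :
    blockSum l m + blockSum l' m' = blockSum (l + l') (m + m') := by
  ext i j
  obtain ⟨i, rfl⟩ := (finSumFinEquiv (m := 1) (n := 3)).surjective i
  obtain ⟨j, rfl⟩ := (finSumFinEquiv (m := 1) (n := 3)).surjective j
  rcases i with i | i <;> rcases j with j | j <;> simp [blockSum, Matrix.diagonal_apply]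
  split_ifs <;> simp

theorem blockSum_mul (l l' : ℂ) (m m' : Matrix (Fin 3) (Fin 3) ℂ) :
    blockSum l m * blockSum l' m' = blockSum (l * l') (m * m') := by
  simp [blockSum, Matrix.submatrix_mul_equiv, Matrix.fromBlocks_multiply]

theorem blockSum_smul (r : ℝ) (l : ℂ) (m : Matrix (Fin 3) (Fin 3) ℂ) :
    r • blockSum l m = blockSum (r • l) (r • m) := by
  ext i j
  obtain ⟨i, rfl⟩ := (finSumFinEquiv (m := 1) (n := 3)).surjective i
  obtain ⟨j, rfl⟩ := (finSumFinEquiv (m := 1) (n := 3)).surjective j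
  rcases i with i | i <;> rcases j with j | j <;> simp [blockSum, Matrix.diagonal_apply]

theorem blockSum_star (l : ℂ) (m : Matrix (Fin 3) (Fin 3) ℂ) :
    star (blockSum l m) = blockSum (star l) (star m) := by
  simp [blockSum, Matrix.star_eq_conjTranspose, Matrix.fromBlocks_conjTranspose]
  rfl

/-- The subalgebra `A_F = {((λ ⊕ conj λ) ⊕ q, λ ⊕ m) | λ ∈ ℂ, q ∈ ℍ, m ∈ M₃(ℂ)}` of `A^ev`;
`λ ⊕ conj λ` is the matrix of `λ ∈ ℂ ⊂ ℍ`. -/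
def algF : NonUnitalStarSubalgebra ℝ EvAlg where
  carrier := {a | ∃ (l : ℂ) (q : Quaternion ℝ) (m : Matrix (Fin 3) (Fin 3) ℂ),
    a = ((l : Quaternion ℝ), q, blockSum l m)}
  zero_mem' := ⟨0, 0, 0, by simp [blockSum_zero]; rfl⟩
  add_mem' := by
    rintro _ _ ⟨l, q, m, rfl⟩ ⟨l', q', m', rfl⟩
    exact ⟨l + l', q + q', m + m', by simp [blockSum_add]⟩
  mul_mem' := by
    rintro _ _ ⟨l, q, m, rfl⟩ ⟨l', q', m', rfl⟩
    exact ⟨l * l', q * q', m * m', by simp [blockSum_mul]⟩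
  smul_mem' := by
    rintro r _ ⟨l, q, m, rfl⟩
    exact ⟨r • l, r • q, r • m, by simp [blockSum_smul]⟩
  star_mem' := by
    rintro _ ⟨l, q, m, rfl⟩
    refine ⟨star l, star q, star m, ?_⟩
    refine Prod.ext ?_ (Prod.ext rfl (blockSum_star l m))
    ext <;> simp

/-! Write $D$ in blocks on $M_4(\mathbb C)\oplus M_4(\mathbb C)$. The center of $A$ acts by a scalar
on each summand, so for self-adjoint $D$ being off-diagonal forces the lower left block $N$ to be
nonzero. The order-one condition says that each commutator block $[D,a]_{21}$ intertwines the
actions of $b^\circ$ on the two summands. Either some such block is nonzero, or all vanish and $N$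
itself intertwines the actions of the $a\in B$. Slicing the nonzero intertwiner at a nonzero entry
gives a nonzero $x:\mathbb C^2\to\mathbb C^4$ with $Yx=xp$ for all elements of $B$, where $p$ is one
of the two quaternions (`exists_intertwiner`).

Conjugating by a unit quaternion and a unitary of $M_4(\mathbb C)$ turns $x$ into a $4\times2$
diagonal matrix with entries $\mu>0$, $\nu\ge0$ (`exists_singular_value_decomposition`). Since $B$
is $*$-closed, the relation also holds for adjoints. If $\mu\ne\nu$, it forces $p=\lambda\in\mathbb
C$ and $Y=\lambda\oplus m$, so $B$ lies in a conjugate of $A_F$, of dimension $2+4+18=24$. If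
$\mu=\nu$, then $Y=p\oplus m$ with $m\in M_2(\mathbb C)$, and $\dim B\le 4+4+8=16$
(`le_map_algF_or_finrank_le_of_fst`). Conversely, $A_F$ commutes with an explicit off-diagonal $D$
(`admits_algF`), so 24 is the maximum and is attained only by images of $A_F$. -/

/-! ### Matrix form of the operators and the lower left block of $D$. -/

theorem repEv_eq (a : EvAlg) :
    repEv a = Matrix.toEuclideanCLM (𝕜 := ℂ) (repMatrix (evIncl a)) := rfl

-- The complex conjugation in $J$ turns the adjoint $b^*$ into the transpose, and the exchange of
-- summands becomes the reindexing by `Sum.swap`.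
open scoped Matrix in
theorem opp_eq (b : EvAlg) :
    opp b = Matrix.toEuclideanCLM (𝕜 := ℂ)
      ((repMatrix (evIncl b))ᵀ.submatrix Sum.swap Sum.swap) := by
  ext ψ p
  have h : opp b ψ = realStructure (repEv (star b) (realStructure.symm ψ)) := rfl
  rw [h, repEv_eq, map_star, map_star]
  change star ((star (repMatrix (evIncl b))).mulVec (fun p => star (ψ p.swap)) p.swap) =
    Matrix.mulVec _ ψ.ofLp p
  simp only [Matrix.mulVec, dotProduct, star_sum, star_mul', star_star, Matrix.star_apply,
    Matrix.submatrix_apply, Matrix.transpose_apply]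
  exact Fintype.sum_equiv (Equiv.sumComm _ _) _ _ fun q => by simp

open Kronecker in
theorem repMatrix_apply (a : FullAlg) : repMatrix a = Matrix.fromBlocks
    (quatBlock a.1 ⊗ₖ (1 : Matrix (Fin 4) (Fin 4) ℂ)) 0
    0 ((1 : Matrix (Fin 2 × Fin 2) (Fin 2 × Fin 2) ℂ) ⊗ₖ a.2) := rfl

theorem lie_toEuclideanCLM (M N : Matrix (HalfIdx ⊕ HalfIdx) (HalfIdx ⊕ HalfIdx) ℂ) :
    ⁅Matrix.toEuclideanCLM (𝕜 := ℂ) M, Matrix.toEuclideanCLM (𝕜 := ℂ) N⁆ =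
      Matrix.toEuclideanCLM (𝕜 := ℂ) (M * N - N * M) := by
  simp [Ring.lie_def]

open Kronecker Matrix in
/-- The lower left block of the order-one condition. -/
theorem OrderOne.block {B : NonUnitalStarSubalgebra ℝ EvAlg}
    {M : Matrix (HalfIdx ⊕ HalfIdx) (HalfIdx ⊕ HalfIdx) ℂ}
    (h : OrderOne B (Matrix.toEuclideanCLM (𝕜 := ℂ) M)) {a b : EvAlg} (ha : a ∈ B) (hb : b ∈ B) :
    let G := M.toBlocks₂₁ * (quatBlock (evIncl a).1 ⊗ₖ (1 : Matrix (Fin 4) (Fin 4) ℂ)) -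
      ((1 : Matrix (Fin 2 × Fin 2) (Fin 2 × Fin 2) ℂ) ⊗ₖ a.2.2) * M.toBlocks₂₁
    G * ((1 : Matrix (Fin 2 × Fin 2) (Fin 2 × Fin 2) ℂ) ⊗ₖ b.2.2ᵀ) =
      ((quatBlock (evIncl b).1)ᵀ ⊗ₖ (1 : Matrix (Fin 4) (Fin 4) ℂ)) * G := by
  intro G
  have h1 := h a ha b hb
  rw [repEv_eq, opp_eq, lie_toEuclideanCLM, lie_toEuclideanCLM,
    EmbeddingLike.map_eq_zero_iff, sub_eq_zero] at h1
  have hO : (repMatrix (evIncl b))ᵀ.submatrix Sum.swap Sum.swap = Matrix.fromBlocks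
      ((1 : Matrix (Fin 2 × Fin 2) (Fin 2 × Fin 2) ℂ) ⊗ₖ b.2.2ᵀ) 0
      0 ((quatBlock (evIncl b).1)ᵀ ⊗ₖ (1 : Matrix (Fin 4) (Fin 4) ℂ)) := by
    rw [repMatrix_apply, Matrix.fromBlocks_transpose, ← Matrix.kroneckerMap_transpose,
      ← Matrix.kroneckerMap_transpose]
    simp [evIncl]
  rw [hO, repMatrix_apply, ← Matrix.fromBlocks_toBlocks M] at h1
  simp only [Matrix.fromBlocks_multiply, Matrix.mul_zero, Matrix.zero_mul, zero_add, add_zero,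
    sub_eq_add_neg, Matrix.fromBlocks_neg, Matrix.fromBlocks_add] at h1
  have h2 := (Matrix.fromBlocks_inj.1 h1).2.2.1
  rw [← sub_eq_add_neg] at h2
  exact h2

-- If the block vanished, so would its adjoint, and $D$ would be block diagonal. It would then
-- commute with $Z(A)=\mathbb R\oplus\mathbb C$, which acts by one scalar on each summand.
open Kronecker in
theorem isOffDiagonal_block {M : Matrix (HalfIdx ⊕ HalfIdx) (HalfIdx ⊕ HalfIdx) ℂ}
    (hM : M.IsHermitian) (h : IsOffDiagonal (Matrix.toEuclideanCLM (𝕜 := ℂ) M)) :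
    M.toBlocks₂₁ ≠ 0 := by
  intro h0
  obtain ⟨z, hz, hne⟩ := h
  apply hne
  have h0' : M.toBlocks₁₂ = 0 := by
    ext i j
    have := congrFun (congrFun h0 j) i
    simp only [Matrix.toBlocks₂₁, Matrix.toBlocks₁₂, Matrix.of_apply, Matrix.zero_apply] at this ⊢
    rw [← hM.apply, this, star_zero]
  rw [Subalgebra.mem_center_iff] at hz
  have h1 : z.1 ∈ Set.center (Matrix (Fin 2) (Fin 2) (Quaternion ℝ)) := by
    rw [Semigroup.mem_center_iff]
    intro g
    exact congrArg Prod.fst (hz (g, 0))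
  have h2 : z.2 ∈ Set.center (Matrix (Fin 4) (Fin 4) ℂ) := by
    rw [Semigroup.mem_center_iff]
    intro g
    exact congrArg Prod.snd (hz (0, g))
  rw [Matrix.center_eq_scalar_image] at h1 h2
  obtain ⟨q, hq, hq1⟩ := h1
  obtain ⟨c, -, hc⟩ := h2
  rw [Semigroup.mem_center_iff] at hq
  -- Commuting with the units $i$ and $j$ kills all imaginary parts.
  obtain ⟨r, rfl⟩ : ∃ r : ℝ, (r : Quaternion ℝ) = q := by
    refine ⟨q.re, ?_⟩
    obtain ⟨i, i0, i1, i2, i3⟩ : ∃ i : Quaternion ℝ, i.re = 0 ∧ i.imI = 1 ∧ i.imJ = 0 ∧ i.imK = 0 :=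
      ⟨⟨0, 1, 0, 0⟩, rfl, rfl, rfl, rfl⟩
    obtain ⟨j, j0, j1, j2, j3⟩ : ∃ j : Quaternion ℝ, j.re = 0 ∧ j.imI = 0 ∧ j.imJ = 1 ∧ j.imK = 0 :=
      ⟨⟨0, 0, 1, 0⟩, rfl, rfl, rfl, rfl⟩
    have hi := Quaternion.ext_iff.1 (hq i)
    have hj := Quaternion.ext_iff.1 (hq j)
    simp [i0, i1, i2, i3, j0, j1, j2, j3] at hi hj
    ext <;> simp <;> linarith
  have e1 : quatBlock z.1 = (r : ℂ) • 1 := by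
    rw [← hq1]
    have : Matrix.scalar (Fin 2) (r : Quaternion ℝ) = algebraMap ℝ _ r := by
      refine Matrix.ext fun i j => ?_
      simp [Matrix.algebraMap_matrix_apply, Matrix.diagonal_apply]
    rw [this, AlgHomClass.commutes]
    ext i j; simp [Matrix.algebraMap_matrix_apply, Matrix.one_apply]
  have e2 : z.2 = c • 1 := by
    rw [← hc]; ext i j; simp [Matrix.diagonal_apply, Matrix.one_apply]
  change ⁅_, Matrix.toEuclideanCLM (𝕜 := ℂ) (repMatrix z)⁆ = _
  rw [lie_toEuclideanCLM, EmbeddingLike.map_eq_zero_iff, repMatrix_apply, e1, e2,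
    ← Matrix.fromBlocks_toBlocks M, h0, h0']
  simp [Matrix.fromBlocks_multiply, Matrix.smul_kronecker, Matrix.kronecker_smul]

/-! ### From the order-one condition to an intertwiner. -/

/-- A nonzero intertwiner between the representation of `M₂(ℍ)` on `ℂ⁴` and that of `M₄(ℂ)`. -/
theorem exists_intertwiner_full {B : NonUnitalStarSubalgebra ℝ EvAlg}
    (h : AdmitsOffDiagonalDirac B) :
    ∃ x : Matrix (Fin 4) (Fin 2 × Fin 2) ℂ, x ≠ 0 ∧
      ∀ a ∈ B, a.2.2 * x = x * quatBlock (evIncl a).1 := by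
  obtain ⟨D, hD, hO, hoff⟩ := h
  obtain ⟨M, rfl⟩ := (Matrix.toEuclideanCLM (𝕜 := ℂ) (n := HalfIdx ⊕ HalfIdx)).surjective D
  change IsDirac (Matrix.toEuclideanCLM (𝕜 := ℂ) M) at hD
  change OrderOne B (Matrix.toEuclideanCLM (𝕜 := ℂ) M) at hO
  change IsOffDiagonal (Matrix.toEuclideanCLM (𝕜 := ℂ) M) at hoff
  have hM : M.IsHermitian := by
    have := hD.selfAdjoint.star_eq
    rw [← map_star] at this
    exact (Matrix.toEuclideanCLM (𝕜 := ℂ)).injective this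
  have hN := isOffDiagonal_block hM hoff
  have key := fun a b ha hb => OrderOne.block (a := a) (b := b) hO ha hb
  set N := M.toBlocks₂₁
  clear_value N
  -- The two cases: $[D,a]_{21}=0$ for every $a\in B$, or some $[D,a]_{21}\ne0$.
  by_cases hG : ∀ a ∈ B, N * Matrix.kroneckerMap (· * ·) (quatBlock (evIncl a).1)
      (1 : Matrix (Fin 4) (Fin 4) ℂ) =
      Matrix.kroneckerMap (· * ·) (1 : Matrix (Fin 2 × Fin 2) (Fin 2 × Fin 2) ℂ) a.2.2 * N
  · obtain ⟨⟨β, J⟩, ⟨α, I⟩, hne⟩ : ∃ i j, N i j ≠ 0 := by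
      by_contra! hc
      exact hN (Matrix.ext hc)
    -- The action of $a$ touches only `α` on the source and `J` on the target, so `β` and `I` can be
    -- frozen.
    refine ⟨Matrix.of fun J α => N (β, J) (α, I), fun h0 => hne ?_, fun a ha => ?_⟩
    · exact congrFun (congrFun h0 J) α
    · ext J α
      have := congrFun (congrFun (hG a ha) (β, J)) (α, I)
      simp only [Matrix.mul_apply, Matrix.kroneckerMap_apply, Fintype.sum_prod_type,
        Matrix.one_apply, Matrix.of_apply] at this ⊢
      simpa [Prod.ext_iff, ite_and] using this.symm
  · push Not at hG
    obtain ⟨a, ha, hGa⟩ := hG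
    have key := fun b hb => key a b ha hb
    simp only at key
    rw [← sub_ne_zero] at hGa
    set G := N * Matrix.kroneckerMap (· * ·) (quatBlock (evIncl a).1)
      (1 : Matrix (Fin 4) (Fin 4) ℂ) -
      Matrix.kroneckerMap (· * ·) (1 : Matrix (Fin 2 × Fin 2) (Fin 2 × Fin 2) ℂ) a.2.2 * N
    clear_value G
    obtain ⟨⟨β, J⟩, ⟨α, I⟩, hne⟩ : ∃ i j, G i j ≠ 0 := by
      by_contra! hc
      exact hGa (Matrix.ext hc)
    -- The opposite action touches the other two indices. It acts through transposes, so `I` becomes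
    -- the row index and `β` the column index.
    refine ⟨Matrix.of fun I β => G (β, J) (α, I), fun h0 => hne ?_, fun b hb => ?_⟩
    · exact congrFun (congrFun h0 I) β
    · ext I β
      have := congrFun (congrFun (key b hb) (β, J)) (α, I)
      simp only [Matrix.mul_apply, Matrix.kroneckerMap_apply, Fintype.sum_prod_type,
        Matrix.one_apply, Matrix.of_apply, Matrix.transpose_apply] at this ⊢
      simpa [Prod.ext_iff, ite_and, mul_comm] using this

/-- The even part is diagonal in $M_2(\mathbb H)$, so each pair of columns of the intertwiner with
fixed chirality `c` is itself an intertwiner, and one of the two pairs is nonzero. -/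
theorem exists_intertwiner {B : NonUnitalStarSubalgebra ℝ EvAlg}
    (h : AdmitsOffDiagonalDirac B) :
    ∃ (c : Fin 2) (x : Matrix (Fin 4) (Fin 2) ℂ), x ≠ 0 ∧
      ∀ a ∈ B, a.2.2 * x = x * quatToMatrix (![a.1, a.2.1] c) := by
  obtain ⟨x, hx, hB⟩ := exists_intertwiner_full h
  obtain ⟨i, ⟨c, j⟩, hne⟩ : ∃ i j, x i j ≠ 0 := by
    by_contra! hc
    exact hx (Matrix.ext hc)
  refine ⟨c, Matrix.of fun i j => x i (c, j), fun h0 => hne ?_, fun a ha => ?_⟩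
  · exact congrFun (congrFun h0 i) j
  · ext i j
    have := congrFun (congrFun (hB a ha) i) (c, j)
    have hq : ∀ s t, quatBlock (evIncl a).1 s t =
        if s.1 = t.1 then quatToMatrix (![a.1, a.2.1] t.1) s.2 t.2 else 0 := by
      intro s t
      change quatToMatrix (Matrix.diagonal ![a.1, a.2.1] s.1 t.1) s.2 t.2 = _
      by_cases hst : s.1 = t.1 <;> simp [hst]
    simp only [Matrix.mul_apply, Fintype.sum_prod_type, Matrix.of_apply, hq] at this ⊢
    rw [this, Finset.sum_eq_single c] <;> simp +contextual

/-! ### Unit quaternions as $SU(2)$, and diagonalization. -/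

/-- A unit vector of `ℂ²` is the first column of a unit quaternion. -/
theorem exists_unit_quaternion_col (v : Fin 2 → ℂ) (hv : ∑ i, ‖v i‖ ^ 2 = 1) :
    ∃ u : unitary (Quaternion ℝ), ∀ i, quatToMatrix u i 0 = v i := by
  have hn : (v 0).re ^ 2 + (v 0).im ^ 2 + (v 1).re ^ 2 + (v 1).im ^ 2 = 1 := by
    simp only [Fin.sum_univ_two, Complex.sq_norm, Complex.normSq_apply] at hv
    linarith
  -- The second entry of the first column of `quatToMatrix` has real part `-imJ`, hence the sign.
  obtain ⟨u, h0, h1, h2, h3⟩ : ∃ u : Quaternion ℝ, u.re = (v 0).re ∧ u.imI = (v 0).im ∧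
      u.imJ = -(v 1).re ∧ u.imK = (v 1).im := ⟨⟨_, _, _, _⟩, rfl, rfl, rfl, rfl⟩
  refine ⟨⟨u, Unitary.mem_iff.2 ?_⟩, fun i => ?_⟩
  · have hu : Quaternion.normSq u = 1 := by
      rw [Quaternion.normSq_def', h0, h1, h2, h3]
      linarith
    simp [Quaternion.star_mul_self, Quaternion.self_mul_star, hu]
  · fin_cases i <;> simp [quatToMatrix, h0, h1, h2, h3]

/-- Pairwise orthogonal vectors of `ℂ⁴` are multiples of the columns of a unitary matrix. -/
theorem exists_unitary_of_orthogonal (g : Fin 4 → EuclideanSpace ℂ (Fin 4))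
    (hg : ∀ i j, i ≠ j → inner ℂ (g i) (g j) = 0) :
    ∃ U : unitary (Matrix (Fin 4) (Fin 4) ℂ), ∀ i j, g j i = ‖g j‖ * U.1 i j := by
  -- Only the nonzero vectors are normalized. The columns at the remaining indices come from the
  -- extension to an orthonormal basis.
  have hf : Orthonormal ℂ ({j | g j ≠ 0}.domRestrict fun j => ((‖g j‖ : ℂ)⁻¹) • g j) := by
    constructor
    · rintro ⟨j, hj⟩
      have : ‖g j‖ ≠ 0 := norm_ne_zero_iff.2 hj
      simp [norm_smul, this]
    · rintro ⟨i, hi⟩ ⟨j, hj⟩ hij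
      have : i ≠ j := fun h => hij (Subtype.ext h)
      simp [inner_smul_left, inner_smul_right, hg i j this]
  obtain ⟨b, hb⟩ := hf.exists_orthonormalBasis_extension_of_card_eq (by simp)
  have h : star (Matrix.of fun i j => b j i) * (Matrix.of fun i j => b j i) = 1 := by
    ext i j
    have := orthonormal_iff_ite.1 b.orthonormal i j
    rw [PiLp.inner_apply] at this
    simp only [Matrix.mul_apply, Matrix.star_apply, Matrix.of_apply, Matrix.one_apply, ← this]
    exact Finset.sum_congr rfl fun k _ => by simp [mul_comm]
  refine ⟨⟨Matrix.of fun i j => b j i, Unitary.mem_iff.2 ⟨h, mul_eq_one_comm.1 h⟩⟩, fun i j => ?_⟩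
  by_cases hj : g j = 0
  · simp [hj]
  · have : (‖g j‖ : ℂ) ≠ 0 := by exact_mod_cast norm_ne_zero_iff.2 hj
    simp [hb j hj, mul_inv_cancel_left₀ this]

/-- A nonzero Hermitian `2 × 2` matrix is diagonalized by a unit quaternion, with nonzero first
eigenvalue. -/
theorem exists_unit_quaternion_diagonal {h : Matrix (Fin 2) (Fin 2) ℂ} (hh : h.IsHermitian)
    (h0 : h ≠ 0) :
    ∃ (u : unitary (Quaternion ℝ)) (μ ν : ℂ), μ ≠ 0 ∧
      star (quatToMatrix u) * h * quatToMatrix u = !![μ, 0; 0, ν] := by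
  obtain ⟨k, hk⟩ : ∃ k, hh.eigenvalues k ≠ 0 := by
    by_contra! hc
    exact h0 (hh.eigenvalues_eq_zero_iff.1 (funext hc))
  set v := hh.eigenvectorBasis k with hv
  have hnv : ∑ i, ‖v i‖ ^ 2 = 1 := by
    rw [← EuclideanSpace.norm_sq_eq, hh.eigenvectorBasis.orthonormal.1 k, one_pow]
  obtain ⟨u, hu⟩ := exists_unit_quaternion_col v hnv
  have hev := hh.mulVec_eigenvectorBasis k
  have hcol : ∀ i, (h * quatToMatrix u) i 0 = hh.eigenvalues k * quatToMatrix u i 0 := by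
    intro i
    have := congrFun hev i
    rw [hu, Matrix.mul_apply]
    simp only [hu]
    exact this
  have huu : star (quatToMatrix u) * quatToMatrix u = 1 := by
    rw [← map_star, ← map_mul, Unitary.star_mul_self_of_mem u.2, map_one]
  set K := star (quatToMatrix u) * h * quatToMatrix u with hK
  have hKH : K.IsHermitian := Matrix.isHermitian_conjTranspose_mul_mul _ hh
  have hK0 : ∀ i, K i 0 = hh.eigenvalues k * (1 : Matrix (Fin 2) (Fin 2) ℂ) i 0 := by
    intro i
    rw [hK, mul_assoc, Matrix.mul_apply, ← huu, Matrix.mul_apply, Finset.mul_sum]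
    exact Finset.sum_congr rfl fun j _ => by rw [hcol]; ring
  refine ⟨u, hh.eigenvalues k, K 1 1, by exact_mod_cast hk, ?_⟩
  -- The first column of `u` is an eigenvector, which fixes the first column of `K`; hermiticity
  -- gives the other off-diagonal zero.
  have h10 : K 1 0 = 0 := by simp [hK0]
  ext i j
  fin_cases i <;> fin_cases j
  · change K 0 0 = _
    simp [hK0]
  · change K 0 1 = 0
    rw [← hKH.apply, h10, star_zero]
  · exact h10
  · rfl

/-! ### Structure and dimension of $A_F$, and automorphisms of $A^{\mathrm{ev}}$. -/

theorem finrank_algF_model :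
    Module.finrank ℝ (ℂ × Quaternion ℝ × Matrix (Fin 3) (Fin 3) ℂ) = 24 := by
  simp [Module.finrank_prod, Module.finrank_matrix, Quaternion.finrank_eq_four]

theorem blockSum_injective {l l' : ℂ} {m m' : Matrix (Fin 3) (Fin 3) ℂ}
    (h : blockSum l m = blockSum l' m') : l = l' ∧ m = m' := by
  simp only [blockSum, EmbeddingLike.apply_eq_iff_eq, Matrix.fromBlocks_inj] at h
  exact ⟨by simpa using congrFun (congrFun h.1 0) 0, h.2.2.2⟩

/-- The isomorphism `ℂ ⊕ ℍ ⊕ M₃(ℂ) ≅ A_F`. -/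
noncomputable def algFHom :
    (ℂ × Quaternion ℝ × Matrix (Fin 3) (Fin 3) ℂ) →⋆ₙₐ[ℝ] algF where
  toFun a := ⟨((a.1 : Quaternion ℝ), a.2.1, blockSum a.1 a.2.2), a.1, a.2.1, a.2.2, rfl⟩
  map_smul' r a := Subtype.ext (by
    simp only [Prod.smul_fst, Prod.smul_snd, ← blockSum_smul]
    refine Prod.ext ?_ rfl
    ext <;> simp)
  map_zero' := Subtype.ext (by simp [blockSum_zero])
  map_add' a b := Subtype.ext (by simp [blockSum_add])
  map_mul' a b := Subtype.ext (by simp [blockSum_mul])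
  map_star' a := Subtype.ext (by
    refine Prod.ext ?_ (Prod.ext rfl (blockSum_star _ _).symm)
    ext <;> simp)

theorem algFHom_bijective : Function.Bijective algFHom := by
  constructor
  · rintro ⟨l, q, m⟩ ⟨l', q', m'⟩ h
    have h1 := congrArg Subtype.val h
    have h2 : q = q' := congrArg (fun a => a.2.1) h1
    have h3 : blockSum l m = blockSum l' m' := congrArg (fun a => a.2.2) h1
    obtain ⟨rfl, rfl⟩ := blockSum_injective h3
    rw [h2]
  · rintro ⟨_, l, q, m, rfl⟩
    exact ⟨(l, q, m), rfl⟩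

theorem finrank_algF : Module.finrank ℝ algF = 24 := by
  rw [← finrank_algF_model]
  exact (LinearEquiv.ofBijective (algFHom : _ →ₗ[ℝ] algF) algFHom_bijective).finrank_eq.symm

/-- The automorphism of `A^ev` exchanging the two copies of `ℍ`. -/
def evSwap : EvAlg ≃⋆ₐ[ℝ] EvAlg where
  toFun a := (a.2.1, a.1, a.2.2)
  invFun a := (a.2.1, a.1, a.2.2)
  left_inv _ := rfl
  right_inv _ := rfl
  map_mul' _ _ := rfl
  map_add' _ _ := rfl
  map_star' _ := rfl
  map_smul' _ _ := rfl

/-- The unitary `(u, 1, U)` of `A^ev`. -/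
def evUnitary (u : unitary (Quaternion ℝ)) (U : unitary (Matrix (Fin 4) (Fin 4) ℂ)) :
    unitary EvAlg :=
  ⟨(u, 1, U), Unitary.mem_iff.2
    ⟨by simp [Prod.ext_iff], by simp [Prod.ext_iff]⟩⟩

/-! ### Normal form of the intertwiner and its consequences for $B$. -/

open scoped ComplexOrder in
/-- A singular value decomposition of a `4 × 2` matrix, by a unit quaternion on the right. -/
theorem exists_singular_value_decomposition {x : Matrix (Fin 4) (Fin 2) ℂ} (hx : x ≠ 0) :
    ∃ (u : unitary (Quaternion ℝ)) (U : unitary (Matrix (Fin 4) (Fin 4) ℂ)) (μ ν : ℝ),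
      0 < μ ∧ 0 ≤ ν ∧
      star U.1 * x * quatToMatrix u = !![(μ : ℂ), 0; 0, (ν : ℂ); 0, 0; 0, 0] := by
  obtain ⟨u, μ, ν, hμ, hd⟩ := exists_unit_quaternion_diagonal
    (Matrix.isHermitian_conjTranspose_mul_self x) (mt Matrix.conjTranspose_mul_self_eq_zero.1 hx)
  set w := x * quatToMatrix u with hw
  have hww : w.conjTranspose * w = !![μ, 0; 0, ν] := by
    rw [← hd, hw, Matrix.conjTranspose_mul, Matrix.star_eq_conjTranspose]
    simp only [Matrix.mul_assoc]
  -- The two columns of `w` are orthogonal because `wᴴ * w` is diagonal; zeros pad them to four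
  -- vectors.
  set g : Fin 4 → EuclideanSpace ℂ (Fin 4) :=
    ![WithLp.toLp 2 fun i => w i 0, WithLp.toLp 2 fun i => w i 1, 0, 0] with hg
  have h01 : inner ℂ (g 0) (g 1) = 0 := by
    have := congrFun (congrFun hww 0) 1
    simp only [Matrix.mul_apply, Matrix.conjTranspose_apply] at this
    rw [PiLp.inner_apply]
    simpa [hg, mul_comm] using this
  have h10 : inner ℂ (g 1) (g 0) = 0 := inner_eq_zero_symm.1 h01
  have h00 : g 0 ≠ 0 := by
    intro h0
    apply hμ
    have := congrFun (congrFun hww 0) 0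
    have hw0 : ∀ i, w i 0 = 0 := fun i => congrArg (fun v : EuclideanSpace ℂ (Fin 4) => v i) h0
    simpa [Matrix.mul_apply, hw0] using this.symm
  obtain ⟨U, hU⟩ := exists_unitary_of_orthogonal g (by
    intro i j hij
    fin_cases i <;> fin_cases j <;> first | exact absurd rfl hij | exact h01 | exact h10 | simp [hg])
  have hUU : star U.1 * U.1 = 1 := Unitary.star_mul_self_of_mem U.2
  have key : ∀ i j, ∑ k, star (U.1 k i) * g j k = ‖g j‖ * (1 : Matrix (Fin 4) (Fin 4) ℂ) i j := by
    intro i j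
    rw [← hUU, Matrix.mul_apply, Finset.mul_sum]
    exact Finset.sum_congr rfl fun k _ => by rw [hU, Matrix.star_apply]; ring
  refine ⟨u, U, ‖g 0‖, ‖g 1‖, norm_pos_iff.2 h00, norm_nonneg _, ?_⟩
  rw [Matrix.mul_assoc, ← hw]
  ext i j
  fin_cases j
  · refine (key i 0).trans ?_
    rw [Matrix.one_apply]
    fin_cases i <;> simp
  · refine (key i 1).trans ?_
    rw [Matrix.one_apply]
    fin_cases i <;> simp

theorem intertwiner_conj {x : Matrix (Fin 4) (Fin 2) ℂ} {u : unitary (Quaternion ℝ)}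
    {U : unitary (Matrix (Fin 4) (Fin 4) ℂ)} {e : Matrix (Fin 4) (Fin 2) ℂ}
    (h : star U.1 * x * quatToMatrix u = e) {p : Quaternion ℝ} {Y : Matrix (Fin 4) (Fin 4) ℂ}
    (hY : Y * x = x * quatToMatrix p) :
    (star U.1 * Y * U.1) * e = e * quatToMatrix (star u.1 * p * u.1) := by
  have h1 : U.1 * star U.1 = 1 := Unitary.mul_star_self_of_mem U.2
  have h2 : quatToMatrix u.1 * quatToMatrix (star u.1) = 1 := by
    rw [← map_mul, Unitary.mul_star_self_of_mem u.2, map_one]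
  rw [← h, map_mul, map_mul]
  have e1 : (star U.1 * Y * U.1) * (star U.1 * x * quatToMatrix u.1) =
      star U.1 * (Y * ((U.1 * star U.1) * x)) * quatToMatrix u.1 := by
    simp only [Matrix.mul_assoc]
  have e2 : star U.1 * x * quatToMatrix u.1 *
      (quatToMatrix (star u.1) * quatToMatrix p * quatToMatrix u.1) =
      star U.1 * (x * ((quatToMatrix u.1 * quatToMatrix (star u.1)) * quatToMatrix p)) *
        quatToMatrix u.1 := by
    simp only [Matrix.mul_assoc]
  rw [e1, e2, h1, h2, Matrix.one_mul, Matrix.one_mul, hY]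

theorem eq_blockSum {Y : Matrix (Fin 4) (Fin 4) ℂ} {l : ℂ} (h00 : Y 0 0 = l)
    (hc : ∀ i : Fin 3, Y i.succ 0 = 0) (hr : ∀ i : Fin 3, Y 0 i.succ = 0) :
    Y = blockSum l (Y.submatrix Fin.succ Fin.succ) := by
  subst h00
  ext i j
  have hs : ∀ i : Fin 3, (finSumFinEquiv (m := 1) (n := 3)).symm i.succ = Sum.inr i := by
    intro i; fin_cases i <;> rfl
  have h0 : (finSumFinEquiv (m := 1) (n := 3)).symm 0 = Sum.inl 0 := rfl
  refine Fin.cases ?_ (fun i => ?_) i <;> refine Fin.cases ?_ (fun j => ?_) j <;>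
    simp [blockSum, hs, h0, hc, hr]

/-- The entries of a pair `(p, Y)` intertwined by a `4 × 2` diagonal matrix. -/
theorem intertwiner_entries {μ ν : ℝ} (hμ : 0 < μ) {p : Quaternion ℝ}
    {Y : Matrix (Fin 4) (Fin 4) ℂ}
    (h : Y * !![(μ : ℂ), 0; 0, (ν : ℂ); 0, 0; 0, 0] =
      !![(μ : ℂ), 0; 0, (ν : ℂ); 0, 0; 0, 0] * quatToMatrix p) :
    Y 0 0 = ⟨p.re, p.imI⟩ ∧ Y 1 0 * μ = ν * ⟨-p.imJ, p.imK⟩ ∧ Y 2 0 = 0 ∧ Y 3 0 = 0 ∧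
      Y 0 1 * ν = μ * ⟨p.imJ, p.imK⟩ ∧ Y 1 1 * ν = ν * ⟨p.re, -p.imI⟩ ∧
      Y 2 1 * ν = 0 ∧ Y 3 1 * ν = 0 := by
  have hμ' : (μ : ℂ) ≠ 0 := by exact_mod_cast hμ.ne'
  have e := fun i j => congrFun (congrFun h i) j
  simp [Matrix.mul_apply, Fin.sum_univ_four, Fin.sum_univ_two, quatToMatrix, Fin.forall_fin_succ, hμ'] at e
  obtain ⟨⟨a1, a2⟩, ⟨b1, b2⟩, ⟨c1, c2⟩, d1, d2⟩ := e
  refine ⟨mul_right_cancel₀ hμ' (a1.trans (mul_comm _ _)), b1, c1, d1, a2, b2, ?_, ?_⟩ <;> simpa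

/-- An involutive subalgebra with a nonzero intertwiner `ℂ² → ℂ⁴` is contained in a conjugate of
`A_F`, or it is contained in a conjugate of `{(p, q, p ⊕ m)}` and has dimension at most `16`. -/
theorem le_map_algF_or_finrank_le_of_fst {B : NonUnitalStarSubalgebra ℝ EvAlg}
    {x : Matrix (Fin 4) (Fin 2) ℂ} (hx : x ≠ 0)
    (hB : ∀ a ∈ B, a.2.2 * x = x * quatToMatrix a.1) :
    (∃ φ : EvAlg ≃⋆ₐ[ℝ] EvAlg, B ≤ algF.map φ) ∨ Module.finrank ℝ B ≤ 16 := by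
  obtain ⟨u, U, μ, ν, hμ, hν, he⟩ := exists_singular_value_decomposition hx
  have hμ' : (μ : ℂ) ≠ 0 := by exact_mod_cast hμ.ne'
  have h1 := fun a ha => intertwiner_entries hμ (intertwiner_conj he (hB a ha))
  -- Closure under the involution gives the same relations for the adjoints, which control the first
  -- two rows of $Y$ as `h1` controls its first two columns.
  have h2 : ∀ a ∈ B, _ := fun a ha => h1 (star a) (star_mem ha)
  have hUU : U.1 * star U.1 = 1 := Unitary.mul_star_self_of_mem U.2
  have huu : u.1 * star u.1 = 1 := Unitary.mul_star_self_of_mem u.2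
  have hY : ∀ a : EvAlg, star U.1 * (star a).2.2 * U.1 = star (star U.1 * a.2.2 * U.1) := by
    intro a
    simp [mul_assoc]
  have hp : ∀ a : EvAlg, star u.1 * (star a).1 * u.1 = star (star u.1 * a.1 * u.1) := by
    intro a
    simp [mul_assoc]
  simp only [hY, hp, Matrix.star_apply, Quaternion.re_star, Quaternion.imI_star,
    Quaternion.imJ_star, Quaternion.imK_star, neg_neg, star_eq_zero] at h2
  by_cases hne : μ = ν
  · right
    subst hne
    -- For $\mu=\nu$ the conjugated $Y$ is block diagonal with upper block determined by $p$, so the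
    -- two quaternions and the lower $2\times2$ block determine the element.
    let L : B →ₗ[ℝ] Quaternion ℝ × Quaternion ℝ × Matrix (Fin 2) (Fin 2) ℂ :=
      { toFun := fun a => (a.1.1, a.1.2.1, (star U.1 * a.1.2.2 * U.1).submatrix ![2, 3] ![2, 3])
        map_add' := fun a b => by
          refine Prod.ext rfl (Prod.ext rfl ?_)
          change (star U.1 * (a.1.2.2 + b.1.2.2) * U.1).submatrix _ _ = _
          rw [mul_add, add_mul]
          rfl
        map_smul' := fun r a => by
          refine Prod.ext rfl (Prod.ext rfl ?_)
          change (star U.1 * (r • a.1.2.2) * U.1).submatrix _ _ = _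
          rw [mul_smul_comm, smul_mul_assoc]
          rfl }
    have hL : Function.Injective L := by
      rw [← LinearMap.ker_eq_bot, LinearMap.ker_eq_bot']
      rintro ⟨a, ha⟩ h
      obtain ⟨ha1, h'⟩ := Prod.ext_iff.1 h
      obtain ⟨ha2, ha3⟩ := Prod.ext_iff.1 h'
      change a.1 = 0 at ha1
      change a.2.1 = 0 at ha2
      have hm := fun i j => congrFun (congrFun ha3 i) j
      have h1 := h1 a ha
      have h2 := h2 a ha
      have hz : star U.1 * a.2.2 * U.1 = 0 := by
        change ∀ i j, (star U.1 * a.2.2 * U.1) (![2, 3] i) (![2, 3] j) = 0 at hm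
        have hp0 : star u.1 * a.1 * u.1 = 0 := by rw [ha1, mul_zero, zero_mul]
        have hre : (star u.1 * a.1 * u.1).re = 0 := by rw [hp0]; rfl
        have hI : (star u.1 * a.1 * u.1).imI = 0 := by rw [hp0]; rfl
        have hJ : (star u.1 * a.1 * u.1).imJ = 0 := by rw [hp0]; rfl
        have hK : (star u.1 * a.1 * u.1).imK = 0 := by rw [hp0]; rfl
        have hc : (⟨0, 0⟩ : ℂ) = 0 := rfl
        simp only [hre, hI, hJ, hK, neg_zero, hc, mul_zero, mul_eq_zero, hμ', or_false,
          star_eq_zero] at h1 h2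
        simp only [Fin.forall_fin_two, Matrix.cons_val_zero, Matrix.cons_val_one] at hm
        obtain ⟨a00, a10, a20, a30, a01, a11, a21, a31⟩ := h1
        obtain ⟨-, -, b20, b30, -, -, b21, b31⟩ := h2
        obtain ⟨⟨c22, c23⟩, c32, c33⟩ := hm
        ext i j
        fin_cases i <;> fin_cases j <;> assumption
      have ha4 : a.2.2 = 0 := by
        have : U.1 * (star U.1 * a.2.2 * U.1) * star U.1 = (U.1 * star U.1) * a.2.2 * (U.1 * star U.1) := by
          simp only [mul_assoc]
        rwa [hz, hUU, one_mul, mul_one, mul_zero, zero_mul, eq_comm] at this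
      exact Subtype.ext (Prod.ext ha1 (Prod.ext ha2 ha4))
    refine (LinearMap.finrank_le_finrank_of_injective hL).trans ?_
    simp [Module.finrank_prod, Module.finrank_matrix, Quaternion.finrank_eq_four]
  · left
    refine ⟨Unitary.conjStarAlgAut ℝ EvAlg (evUnitary u U), fun a ha => ?_⟩
    have h1 := h1 a ha
    have h2 := h2 a ha
    rw [NonUnitalStarSubalgebra.mem_map]
    generalize hYd : star U.1 * a.2.2 * U.1 = Y at *
    generalize hpd : star u.1 * a.1 * u.1 = p at *
    have hdet : (μ : ℂ) ^ 2 - ν ^ 2 ≠ 0 := by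
      intro h
      have h3 : μ ^ 2 = ν ^ 2 := by exact_mod_cast sub_eq_zero.1 h
      exact hne ((sq_eq_sq₀ hμ.le hν).1 h3)
    -- The relation and the conjugate of its adjoint form a homogeneous system in an off-diagonal
    -- entry of $Y$ and the $j,k$ part of $p$, with determinant $\pm(\mu^2-\nu^2)\neq0$. This also
    -- covers $\nu=0$.
    have solve : ∀ y z : ℂ, y * μ = ν * z → y * ν = μ * z → y = 0 ∧ z = 0 := by
      intro y z e1 e2
      constructor
      · refine (mul_eq_zero.1 (?_ : ((μ : ℂ) ^ 2 - ν ^ 2) * y = 0)).resolve_left hdet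
        linear_combination μ * e1 - ν * e2
      · refine (mul_eq_zero.1 (?_ : ((μ : ℂ) ^ 2 - ν ^ 2) * z = 0)).resolve_left hdet
        linear_combination ν * e1 - μ * e2
    obtain ⟨a00, a10, a20, a30, a01, -, -, -⟩ := h1
    obtain ⟨-, b10, b20, b30, b01, -, -, -⟩ := h2
    have c1 := solve _ _ a10 (by
      have := congrArg star b01
      simp only [star_mul', star_star] at this
      simp only [Complex.star_def, Complex.conj_ofReal] at this
      rw [this]
      congr 1
      simp [Complex.ext_iff])
    have c2 := (solve _ _ b10 (by
      have := congrArg star a01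
      simp only [star_mul', Complex.star_def, Complex.conj_ofReal] at this ⊢
      rw [this]
      congr 1)).1
    have hJ : p.imJ = 0 ∧ p.imK = 0 := by simpa [Complex.ext_iff] using c1.2
    refine ⟨((⟨p.re, p.imI⟩ : ℂ), a.2.1, blockSum ⟨p.re, p.imI⟩ (Y.submatrix Fin.succ Fin.succ)),
      ⟨_, _, _, rfl⟩, ?_⟩
    rw [← eq_blockSum a00 (by simp [Fin.forall_fin_succ, c1.1, a20, a30])
      (fun i => by fin_cases i; exacts [star_eq_zero.1 c2, b20, b30])]
    have hpp : Quaternion.coeComplex ⟨p.re, p.imI⟩ = p := by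
      ext <;> simp [hJ]
    rw [hpp, Unitary.conjStarAlgAut_apply]
    refine Prod.ext ?_ (Prod.ext ?_ ?_)
    · change u.1 * p * star u.1 = a.1
      rw [← hpd]
      have : u.1 * (star u.1 * a.1 * u.1) * star u.1 = (u.1 * star u.1) * a.1 * (u.1 * star u.1) := by
        simp only [mul_assoc]
      rw [this, huu, one_mul, mul_one]
    · change 1 * a.2.1 * star 1 = a.2.1
      simp
    · change U.1 * Y * star U.1 = a.2.2
      rw [← hYd]
      have : U.1 * (star U.1 * a.2.2 * U.1) * star U.1 = (U.1 * star U.1) * a.2.2 * (U.1 * star U.1) := by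
        simp only [mul_assoc]
      rw [this, hUU, one_mul, mul_one]

/-- If the intertwiner involves the second quaternion, the swap of the two copies of $\mathbb H$
reduces to the first. -/
theorem AdmitsOffDiagonalDirac.le_map_algF_or_finrank_le {B : NonUnitalStarSubalgebra ℝ EvAlg}
    (h : AdmitsOffDiagonalDirac B) :
    (∃ φ : EvAlg ≃⋆ₐ[ℝ] EvAlg, B ≤ algF.map φ) ∨ Module.finrank ℝ B ≤ 16 := by
  obtain ⟨c, x, hx, hB⟩ := exists_intertwiner h
  fin_cases c
  · exact le_map_algF_or_finrank_le_of_fst hx hB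
  · have hB' : ∀ a ∈ B.map evSwap, a.2.2 * x = x * quatToMatrix a.1 := by
      intro a ha
      obtain ⟨b, hb, rfl⟩ := NonUnitalStarSubalgebra.mem_map.1 ha
      exact hB b hb
    refine (le_map_algF_or_finrank_le_of_fst hx hB').imp ?_ ?_
    · rintro ⟨φ, hφ⟩
      refine ⟨φ.trans evSwap, fun b hb => ?_⟩
      obtain ⟨a, ha, hab⟩ := NonUnitalStarSubalgebra.mem_map.1
        (hφ (NonUnitalStarSubalgebra.mem_map.2 ⟨b, hb, rfl⟩))
      refine NonUnitalStarSubalgebra.mem_map.2 ⟨a, ha, ?_⟩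
      change evSwap (φ a) = b
      exact (congrArg evSwap hab).trans rfl
    · intro hr
      have : Module.Finite ℝ (B.map evSwap) := FiniteDimensional.finiteDimensional_submodule
        (B.map evSwap).toNonUnitalSubalgebra.toSubmodule
      refine le_trans (LinearMap.finrank_le_finrank_of_injective (f :=
        { toFun := fun b : B => (⟨evSwap b, NonUnitalStarSubalgebra.mem_map.2 ⟨b, b.2, rfl⟩⟩ :
            B.map evSwap)
          map_add' := fun _ _ => rfl
          map_smul' := fun _ _ => rfl }) fun b b' hbb => ?_) hr
      exact Subtype.ext (evSwap.injective (congrArg Subtype.val hbb))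

theorem finrank_map_algF (φ : EvAlg ≃⋆ₐ[ℝ] EvAlg) :
    Module.finrank ℝ (algF.map φ) = Module.finrank ℝ algF :=
  (LinearEquiv.finrank_eq
    ((φ.toAlgEquiv.toLinearEquiv).submoduleMap algF.toNonUnitalSubalgebra.toSubmodule)).symm

/-! ### An explicit Dirac operator for $A_F$. -/

/-- The operator with matrix units exchanging the basis vectors `((0, 0), 0)` of the two summands
of the Hilbert space. -/
noncomputable def diracMatrix : Matrix (HalfIdx ⊕ HalfIdx) (HalfIdx ⊕ HalfIdx) ℂ :=
  Matrix.fromBlocks 0 (Matrix.single ((0, 0), 0) ((0, 0), 0) 1)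
    (Matrix.single ((0, 0), 0) ((0, 0), 0) 1) 0

theorem isDirac_diracMatrix : IsDirac (Matrix.toEuclideanCLM (𝕜 := ℂ) diracMatrix) := by
  refine ⟨?_, fun ψ => ?_, ?_⟩
  · change star _ = _
    rw [← map_star]
    congr 1
    simp [diracMatrix, Matrix.star_eq_conjTranspose, Matrix.fromBlocks_conjTranspose]
  · ext p
    change Matrix.mulVec diracMatrix (fun p => star (ψ p.swap)) p =
      star (Matrix.mulVec diracMatrix ψ.ofLp p.swap)
    simp only [Matrix.mulVec, dotProduct, star_sum, star_mul']
    refine Fintype.sum_equiv (Equiv.sumComm _ _) _ _ fun q => ?_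
    rcases p with p | p <;> rcases q with q | q <;>
      simp only [diracMatrix, Matrix.single_apply, Equiv.sumComm_apply, Sum.swap_inl, Sum.swap_inr,
        Matrix.fromBlocks_apply₁₁, Matrix.fromBlocks_apply₁₂, Matrix.fromBlocks_apply₂₁,
        Matrix.fromBlocks_apply₂₂, Matrix.zero_apply] <;>
      simp
  · rw [grading, ← map_mul, ← map_mul, ← map_neg]
    congr 1
    ext p q
    rw [Matrix.mul_diagonal, Matrix.neg_apply, Matrix.diagonal_mul]
    rcases p with p | p <;> rcases q with q | q <;>
      simp only [diracMatrix, Matrix.fromBlocks_apply₁₁, Matrix.fromBlocks_apply₁₂,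
        Matrix.fromBlocks_apply₂₁, Matrix.fromBlocks_apply₂₂, Matrix.zero_apply,
        Matrix.single_apply, zero_mul, mul_zero, neg_zero] <;>
      split_ifs with h <;> first | (simp; done) | (obtain ⟨rfl, rfl⟩ := h; simp [chiralitySign])

/-- Both products equal `c` times the matrix unit at `(k, k)`. -/
theorem single_mul_eq_mul_single {n R : Type*} [Fintype n] [DecidableEq n] [CommSemiring R]
    {k : n} {c : R} {M N : Matrix n n R} (hM : ∀ j, M k j = if j = k then c else 0)
    (hN : ∀ i, N i k = if i = k then c else 0) :
    Matrix.single k k 1 * M = N * Matrix.single k k 1 := by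
  ext i j
  by_cases hi : i = k
  · subst hi
    by_cases hj : j = i
    · subst hj
      simp [hM, hN]
    · simp [hM, hj, Matrix.mul_single_apply_of_ne (hbj := hj)]
  · by_cases hj : j = k
    · subst hj
      simp [hN, hi, Matrix.single_mul_apply_of_ne (h := hi)]
    · simp [Matrix.single_mul_apply_of_ne (h := hi), Matrix.mul_single_apply_of_ne (hbj := hj)]

/-- The two vectors exchanged by $D$ are eigenvectors of $a$ and of $a^*$, and $a$ has the same
eigenvalue $\lambda$ on both. Hence already $[D,a]=0$, and the order-one condition is immediate. -/
theorem admits_algF : AdmitsOffDiagonalDirac algF := by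
  refine ⟨_, isDirac_diracMatrix, ?_, ?_⟩
  · rintro a ⟨l, q, m, rfl⟩ b -
    have h0 : ⁅Matrix.toEuclideanCLM (𝕜 := ℂ) diracMatrix,
        repEv ((l : Quaternion ℝ), q, blockSum l m)⁆ = 0 := by
      rw [repEv_eq, lie_toEuclideanCLM, EmbeddingLike.map_eq_zero_iff, sub_eq_zero,
        repMatrix_apply, diracMatrix, Matrix.fromBlocks_multiply, Matrix.fromBlocks_multiply]
      simp only [Matrix.mul_zero, Matrix.zero_mul, zero_add, add_zero]
      have hk : ∀ j : HalfIdx, j = ((0, 0), 0) ↔ j.1 = (0, 0) ∧ j.2 = 0 := fun j => Prod.ext_iff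
      have hb : ∀ i j, quatBlock (evIncl ((l : Quaternion ℝ), q, blockSum l m)).1 i j =
          quatToMatrix (Matrix.diagonal ![(l : Quaternion ℝ), q] i.1 j.1) i.2 j.2 := fun _ _ => rfl
      have hP : ∀ j, quatBlock (evIncl ((l : Quaternion ℝ), q, blockSum l m)).1 (0, 0) j =
          if j = (0, 0) then l else 0 := by
        rintro ⟨i, j⟩
        rw [hb]
        fin_cases i <;> fin_cases j <;> simp [quatToMatrix] <;> rfl
      have hP' : ∀ j, quatBlock (evIncl ((l : Quaternion ℝ), q, blockSum l m)).1 j (0, 0) =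
          if j = (0, 0) then l else 0 := by
        rintro ⟨i, j⟩
        rw [hb]
        fin_cases i <;> fin_cases j <;> simp [quatToMatrix] <;>
          first | rfl | exact Complex.ext neg_zero rfl
      have hY : ∀ j, blockSum l m 0 j = if j = 0 then l else 0 := by
        intro j
        fin_cases j <;> rfl
      have hY' : ∀ j, blockSum l m j 0 = if j = 0 then l else 0 := by
        intro j
        fin_cases j <;> rfl
      congr 1
      · refine single_mul_eq_mul_single (c := l) (fun j => ?_) fun j => ?_
        · change (1 : Matrix (Fin 2 × Fin 2) (Fin 2 × Fin 2) ℂ) (0, 0) j.1 * blockSum l m 0 j.2 = _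
          rw [hY, Matrix.one_apply]
          simp only [hk]
          grind
        · rw [Matrix.kroneckerMap_apply, hP', Matrix.one_apply]
          simp only [hk]
          grind
      · refine single_mul_eq_mul_single (c := l) (fun j => ?_) fun j => ?_
        · rw [Matrix.kroneckerMap_apply, hP, Matrix.one_apply]
          simp only [hk]
          grind
        · change (1 : Matrix (Fin 2 × Fin 2) (Fin 2 × Fin 2) ℂ) j.1 (0, 0) * blockSum l m j.2 0 = _
          rw [hY', Matrix.one_apply]
          simp only [hk]
          grind
    rw [h0, Ring.lie_def, zero_mul, mul_zero, sub_zero]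
  -- The central projection onto the first summand has a commutator with $D$ whose lower left block
  -- is that of $D$.
  · refine ⟨(1, 0), Subalgebra.mem_center_iff.2 fun b => by simp [Prod.ext_iff], ?_⟩
    change ⁅_, Matrix.toEuclideanCLM (𝕜 := ℂ) (repMatrix (1, 0))⁆ ≠ 0
    rw [lie_toEuclideanCLM, Ne, EmbeddingLike.map_eq_zero_iff]
    intro h
    have := congrFun (congrFun h (Sum.inr ((0, 0), 0))) (Sum.inl ((0, 0), 0))
    simp [repMatrix_apply, diracMatrix, Matrix.fromBlocks_multiply] at this

/-! ### Maximality and uniqueness. -/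

theorem mainTheorem4 :
    IsMaximalAdmitting algF ∧
    (∀ B : NonUnitalStarSubalgebra ℝ EvAlg, IsMaximalAdmitting B →
      ∃ φ : EvAlg ≃⋆ₐ[ℝ] EvAlg, algF.map φ = B) ∧
    Nonempty (algF ≃⋆ₐ[ℝ] (ℂ × Quaternion ℝ × Matrix (Fin 3) (Fin 3) ℂ)) := by
  refine ⟨⟨admits_algF, fun B hB => ?_⟩, fun B hB => ?_,
    ⟨(StarAlgEquiv.ofBijective algFHom algFHom_bijective).symm⟩⟩
  · rcases hB.le_map_algF_or_finrank_le with ⟨φ, hφ⟩ | h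
    · rw [← finrank_map_algF φ]
      exact Submodule.finrank_mono
        (s := B.toNonUnitalSubalgebra.toSubmodule) (t := (algF.map φ).toNonUnitalSubalgebra.toSubmodule) hφ
    · rw [finrank_algF]
      omega
  · have h24 := hB.2 algF admits_algF
    rcases hB.1.le_map_algF_or_finrank_le with ⟨φ, hφ⟩ | h
    · refine ⟨φ, ?_⟩
      rw [← finrank_map_algF φ] at h24
      -- Inclusion in a copy of $A_F$ together with dimension at least 24 is equality.
      have := Submodule.eq_of_le_of_finrank_le
        (S₁ := B.toNonUnitalSubalgebra.toSubmodule) (S₂ := (algF.map φ).toNonUnitalSubalgebra.toSubmodule) hφ h24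
      exact (SetLike.ext fun a => by exact SetLike.ext_iff.1 this a).symm
    · rw [finrank_algF] at h24
      omega
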